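/- Let $m,n\ge 0$ be integers, let $B$ be a complex $m\times n$ matrix and let $L\ge 1$ be an integer. For $p>0$ let $\|B\|_p^S=\bigl(\sum_{i=1}^{\min\{m,n\}}\sigma_i(B)^p\bigr)^{1/p}$ denote the Schatten $p$-norm of $B$, where $\sigma_1(B),\dots,\sigma_{\min\{m,n\}}(B)\ge 0$ are the singular values of $B$ with multiplicity, and for a complex matrix $A=(a_{ij})$ let $\|A\|_2=\bigl(\sum_{i,j}|a_{ij}|^2\bigr)^{1/2}$. Call a sequence of complex matrices $A_1,\dots,A_L$, with $A_l$ of size $m_l\times n_l$, composable if $m_l=n_{l+1}$ for $l=1,\dots,L-1$, so that the product $A_L\cdots A_1$ is defined. Then $$\bigl(\|B\|^S_{2/L}\bigr)^{2/L}=\min\Bigl(\prod_{l=1}^L\|A_l\|_2^2\Bigr)^{1/L}=\min\frac1L\sum_{l=1}^L\|A_l\|_2^2,$$ where both minima are taken over all composable sequences of complex matrices $A_1,\dots,A_L$ (of arbitrary intermediate sizes) such that $A_L\cdots A_1=B$, and both minima are attained. -/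

import Mathlib

/-- The Schatten `p`-norm (for `p > 0`) of a complex `m × n` matrix: the `ℓ^p` (quasi-)norm of its
`min m n` singular values, listed with multiplicity. -/
noncomputable def schattenNorm {m n : ℕ} (p : ℝ) (A : Matrix (Fin m) (Fin n) ℂ) : ℝ :=
  (∑ i ∈ Finset.range (min m n), (Matrix.toEuclideanLin A).singularValues i ^ p) ^ (1 / p)

/-- The Euclidean (Frobenius) norm of a complex matrix, i.e. the square root of the sum of the
squared moduli of its entries. -/
noncomputable def frobeniusNorm {m n : ℕ} (A : Matrix (Fin m) (Fin n) ℂ) : ℝ :=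
  Matrix.frobeniusNormedAddCommGroup.toNorm.norm A

/-- Composable sequences `A₁, …, A_L` of `L` complex matrices for which the product `A_L ⋯ A₁` has
size `m × n`. The intermediate sizes are arbitrary and part of the data. A sequence of length
`L + 1` is a sequence `A₁, …, A_L` together with a last matrix `A_{L+1}` that has as many columns
as `A_L` has rows. -/
inductive ComposableSeq : (L m n : ℕ) → Type
  | nil {n : ℕ} : ComposableSeq 0 n n
  | cons {L m k n : ℕ} (A : Matrix (Fin m) (Fin k) ℂ) (s : ComposableSeq L k n) :
      ComposableSeq (L + 1) m n

namespace ComposableSeq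

/-- The product `A_L ⋯ A₁`. -/
def prod : {L m n : ℕ} → ComposableSeq L m n → Matrix (Fin m) (Fin n) ℂ
  | _, _, _, nil => 1
  | _, _, _, cons A s => A * s.prod

/-- The matrices of the sequence, bundled with their sizes: entry `l` (counted from `0`) is
`A_{l+1}`. -/
def factor : {L m n : ℕ} → ComposableSeq L m n →
    Fin L → (Σ size : ℕ × ℕ, Matrix (Fin size.1) (Fin size.2) ℂ)
  | _, _, _, nil => Fin.elim0
  | _, _, _, cons (m := m) (k := k) A s => Fin.snoc s.factor ⟨(m, k), A⟩

end ComposableSeq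

open Matrix
open scoped ComplexOrder

/-! Fix the sizes of the factors. By compactness some factorisation of `B` with these sizes
minimises the sum of the squared Frobenius norms. At a minimiser, adjacent factors `M`, `N` are
balanced, `Mᴴ * M = N * Nᴴ`: otherwise `M exp(-tH)`, `exp(tH) N` with `H = N * Nᴴ - Mᴴ * M` would do
better for small `t > 0`. Balance telescopes `Bᴴ * B` into `G ^ L`, where `G` is the Gram matrix of
the rightmost factor, and gives every factor squared norm `tr G`, which is the sum of the `σ_i(B) ^
(2/L)`.

So the minimum does not depend on the sizes, which gives the lower bound for the mean. Rescaling the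
factors to equal norms turns this into the bound for the product. A minimiser has equal norms, so it
attains both. -/

/-- The sum of the squared moduli of the entries of a matrix. -/
noncomputable def frobSq {m n : ℕ} (A : Matrix (Fin m) (Fin n) ℂ) : ℝ := ∑ i, ∑ j, ‖A i j‖ ^ 2

theorem frobSq_nonneg {m n : ℕ} (A : Matrix (Fin m) (Fin n) ℂ) : 0 ≤ frobSq A :=
  Finset.sum_nonneg fun _ _ => Finset.sum_nonneg fun _ _ => by positivity

theorem frobeniusNorm_sq {m n : ℕ} (A : Matrix (Fin m) (Fin n) ℂ) :
    frobeniusNorm A ^ 2 = frobSq A := by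
  have h := Matrix.frobenius_norm_def A
  unfold frobeniusNorm
  erw [h]
  rw [← Real.sqrt_eq_rpow, Real.sq_sqrt (by positivity)]
  simp [frobSq]

theorem ofReal_frobSq {m n : ℕ} (A : Matrix (Fin m) (Fin n) ℂ) :
    (frobSq A : ℂ) = (A * Aᴴ).trace := by
  simp [frobSq, trace, mul_apply, Complex.mul_conj, Complex.normSq_eq_norm_sq]

theorem ofReal_frobSq' {m n : ℕ} (A : Matrix (Fin m) (Fin n) ℂ) :
    (frobSq A : ℂ) = (Aᴴ * A).trace := by
  rw [ofReal_frobSq, trace_mul_comm]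

theorem continuous_frobSq {m n : ℕ} :
    Continuous (frobSq : Matrix (Fin m) (Fin n) ℂ → ℝ) := by
  unfold frobSq
  fun_prop

theorem norm_apply_sq_le_frobSq {m n : ℕ} (A : Matrix (Fin m) (Fin n) ℂ) (i : Fin m) (j : Fin n) :
    ‖A i j‖ ^ 2 ≤ frobSq A :=
  (Finset.single_le_sum (f := fun j => ‖A i j‖ ^ 2) (fun _ _ => by positivity)
    (Finset.mem_univ j)).trans
  (Finset.single_le_sum (f := fun i => ∑ j, ‖A i j‖ ^ 2)
    (fun _ _ => Finset.sum_nonneg fun _ _ => by positivity) (Finset.mem_univ i))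

theorem eq_zero_of_frobSq_eq_zero {m n : ℕ} {A : Matrix (Fin m) (Fin n) ℂ} (h : frobSq A = 0) :
    A = 0 := by
  ext i j
  have := norm_apply_sq_le_frobSq A i j
  rw [h] at this
  simpa using le_antisymm this (by positivity)

theorem frobSq_smul {m n : ℕ} (c : ℝ) (A : Matrix (Fin m) (Fin n) ℂ) :
    frobSq ((c : ℂ) • A) = c ^ 2 * frobSq A := by
  simp [frobSq, mul_pow, Finset.mul_sum]

/-! ### Balance of minimal pairs -/

theorem hasDerivAt_linearMap_exp_smul {b : ℕ} (φ : Matrix (Fin b) (Fin b) ℂ →ₗ[ℝ] ℝ)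
    (H : Matrix (Fin b) (Fin b) ℂ) :
    HasDerivAt (fun t : ℝ => φ (NormedSpace.exp (t • H))) (φ H) 0 := by
  let : NormedRing (Matrix (Fin b) (Fin b) ℂ) := Matrix.linftyOpNormedRing
  let : NormedAlgebra ℝ (Matrix (Fin b) (Fin b) ℂ) := Matrix.linftyOpNormedAlgebra
  have h := hasDerivAt_exp_smul_const (𝕂 := ℝ) H 0
  rw [zero_smul, NormedSpace.exp_zero, one_mul] at h
  exact (LinearMap.toContinuousLinearMap φ).hasFDerivAt.comp_hasDerivAt (0 : ℝ) h

/-- If `(M, N)` minimises the total squared Frobenius norm among all pairs with the same product,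
then it is balanced. -/
theorem balanced_of_pair_minimal {a b c : ℕ} (M : Matrix (Fin a) (Fin b) ℂ)
    (N : Matrix (Fin b) (Fin c) ℂ)
    (h : ∀ (M' : Matrix (Fin a) (Fin b) ℂ) (N' : Matrix (Fin b) (Fin c) ℂ),
      M' * N' = M * N → frobSq M + frobSq N ≤ frobSq M' + frobSq N') :
    Mᴴ * M = N * Nᴴ := by
  set H := N * Nᴴ - Mᴴ * M with hH
  have hHH : Hᴴ = H := by simp [hH]
  let E : ℝ → Matrix (Fin b) (Fin b) ℂ := fun t => NormedSpace.exp (t • H)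
  have hE0 : E 0 = 1 := by simp [E]
  have hEd : ∀ (χ : Matrix (Fin b) (Fin b) ℂ →ₗ[ℝ] ℝ) (r : ℝ),
      HasDerivAt (fun t => χ (E (r * t))) (r * χ H) 0 := by
    intro χ r
    have hl : HasDerivAt (fun t : ℝ => r * t) r 0 := by
      simpa using (hasDerivAt_id (0 : ℝ)).const_mul r
    have := HasDerivAt.scomp (0 : ℝ) (h := fun t : ℝ => r * t)
      (by simpa using hasDerivAt_linearMap_exp_smul χ H) hl
    rw [smul_eq_mul] at this
    exact this
  have hEneg : ∀ t, E (-t) * E t = 1 := by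
    intro t
    simp only [E, neg_smul, Matrix.exp_neg]
    exact nonsing_inv_mul _ ((isUnit_iff_isUnit_det _).1 (Matrix.isUnit_exp _))
  have hEH : ∀ t, (E t)ᴴ = E t := by
    intro t
    simp only [E, ← Matrix.exp_conjTranspose, conjTranspose_smul, hHH, star_trivial]
  have hEE : ∀ t, E t * E t = E (2 * t) := by
    intro t
    simp only [E, two_mul, add_smul]
    rw [Matrix.exp_add_of_commute _ _ (Commute.refl _)]
  let φ : Matrix (Fin b) (Fin b) ℂ →ₗ[ℝ] ℝ :=
    Complex.reLm ∘ₗ ((Matrix.traceLinearMap (Fin b) ℂ ℂ).restrictScalars ℝ) ∘ₗ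
      (LinearMap.mulLeft ℝ (N * Nᴴ))
  let ψ : Matrix (Fin b) (Fin b) ℂ →ₗ[ℝ] ℝ :=
    Complex.reLm ∘ₗ ((Matrix.traceLinearMap (Fin b) ℂ ℂ).restrictScalars ℝ) ∘ₗ
      (LinearMap.mulLeft ℝ (Mᴴ * M))
  have hN : ∀ t, frobSq (E t * N) = φ (E (2 * t)) := by
    intro t
    rw [← Complex.ofReal_re (frobSq _), ofReal_frobSq']
    simp only [φ, LinearMap.comp_apply, LinearMap.restrictScalars_apply, LinearMap.mulLeft_apply,
      Matrix.traceLinearMap_apply, ← hEE, conjTranspose_mul, hEH, Complex.reLm_coe]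
    rw [Matrix.trace_mul_comm (N * Nᴴ)]
    rw [Matrix.mul_assoc, Matrix.trace_mul_comm]
    simp only [Matrix.mul_assoc]
  have hM : ∀ t, frobSq (M * E (-t)) = ψ (E (-(2 * t))) := by
    intro t
    rw [← Complex.ofReal_re (frobSq _), ofReal_frobSq]
    simp only [ψ, LinearMap.comp_apply, LinearMap.restrictScalars_apply, LinearMap.mulLeft_apply,
      Matrix.traceLinearMap_apply, ← mul_neg, ← hEE, conjTranspose_mul, hEH, Complex.reLm_coe]
    rw [Matrix.trace_mul_comm (Mᴴ * M), ← Matrix.mul_assoc, Matrix.trace_mul_comm]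
    rw [Matrix.trace_mul_comm]
    simp only [Matrix.mul_assoc]
    rw [Matrix.trace_mul_comm]
    simp only [Matrix.mul_assoc]
  -- With `φ X = Re tr (N * Nᴴ * X)` and `ψ X = Re tr (Mᴴ * M * X)`, this derivative is `2 * Re tr
  -- (H * H)`, which is `2 * frobSq H` as `H` is Hermitian.
  have hd : HasDerivAt (fun t => frobSq (M * E (-t)) + frobSq (E t * N))
      (-2 * ψ H + 2 * φ H) 0 := by
    simp only [hN, hM, ← neg_mul]
    exact (hEd ψ _).add (hEd φ _)
  have hmin : IsLocalMin (fun t => frobSq (M * E (-t)) + frobSq (E t * N)) 0 := by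
    refine Filter.Eventually.of_forall fun t => ?_
    simp only [neg_zero, hE0, Matrix.mul_one, Matrix.one_mul]
    apply h
    rw [Matrix.mul_assoc, ← Matrix.mul_assoc (E (-t)), hEneg, Matrix.one_mul]
  have h0 := hmin.hasDerivAt_eq_zero hd
  have h1 : frobSq H = 0 := by
    rw [← Complex.ofReal_re (frobSq _), ofReal_frobSq, hHH]
    have : (H * H).trace.re = φ H - ψ H := by
      simp only [φ, ψ, LinearMap.comp_apply, LinearMap.restrictScalars_apply,
        LinearMap.mulLeft_apply, Matrix.traceLinearMap_apply, Complex.reLm_coe]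
      rw [← Complex.sub_re, ← trace_sub, ← sub_mul]
    rw [this]
    linarith
  exact (sub_eq_zero.1 (eq_zero_of_frobSq_eq_zero h1)).symm

/-! ### Singular values from an `L`-th root of `Bᴴ * B` -/

theorem roots_charpoly_pow_of_isHermitian {n : ℕ} {G : Matrix (Fin n) (Fin n) ℂ}
    (hG : G.IsHermitian) (L : ℕ) :
    (G ^ L).charpoly.roots =
      Finset.univ.val.map fun i => ((hG.eigenvalues i ^ L : ℝ) : ℂ) := by
  have h : (G ^ L).charpoly = (diagonal fun i => ((hG.eigenvalues i ^ L : ℝ) : ℂ)).charpoly := by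
    conv_lhs => rw [hG.spectral_theorem]
    rw [← map_pow, diagonal_pow, Unitary.conjStarAlgAut_apply]
    rw [Matrix.charpoly_mul_comm, ← mul_assoc, Unitary.coe_star_mul_self, one_mul]
    congr 2
    ext i
    simp
  rw [h, Matrix.charpoly_diagonal, Polynomial.roots_prod]
  · simp only [Polynomial.roots_X_sub_C, Multiset.bind_singleton]
  · exact Finset.prod_ne_zero_iff.2 fun i _ => Polynomial.X_sub_C_ne_zero _

/-- The squared singular values of `B` and the `L`-th powers of the eigenvalues of `G` are the roots
of one characteristic polynomial. Comparing them as multisets avoids matching the two orderings. -/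
theorem sum_singularValues_rpow_eq {L m n : ℕ} (hL : 0 < L) {B : Matrix (Fin m) (Fin n) ℂ}
    {G : Matrix (Fin n) (Fin n) ℂ} (hG : G.PosSemidef) (h : Bᴴ * B = G ^ L) :
    ((∑ i ∈ Finset.range (min m n),
      (Matrix.toEuclideanLin B).singularValues i ^ (2 / (L : ℝ)) : ℝ) : ℂ) = G.trace := by
  set T := Matrix.toEuclideanLin B with hT
  have hL' : (0 : ℝ) < L := by exact_mod_cast hL
  have hn : Module.finrank ℂ (EuclideanSpace ℂ (Fin n)) = n := by simp
  have hTT : LinearMap.adjoint T ∘ₗ T = Matrix.toEuclideanLin (G ^ L) := by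
    rw [hT, ← Matrix.toEuclideanLin_conjTranspose_eq_adjoint, ← h]
    ext x i
    simp [toLpLin_apply]
  have hroots := T.isSymmetric_adjoint_comp_self.roots_charpoly_eq_eigenvalues hn
  have hcp : (LinearMap.adjoint T ∘ₗ T).charpoly = (G ^ L).charpoly := by
    rw [hTT]
    rw [Matrix.toEuclideanLin_eq_toLin_orthonormal, Matrix.charpoly_toLin]
  rw [hcp, roots_charpoly_pow_of_isHermitian hG.1] at hroots
  have hs := congrArg (fun s : Multiset ℂ => (s.map fun z => z.re ^ (1 / (L : ℝ))).sum) hroots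
  simp only [Multiset.map_map, Function.comp_def] at hs
  -- Singular values with index at least `m` vanish because the rank is at most `m`.
  have h1 : ∑ i ∈ Finset.range (min m n), T.singularValues i ^ (2 / (L : ℝ)) =
      ∑ i ∈ Finset.range n, T.singularValues i ^ (2 / (L : ℝ)) := by
    refine Finset.sum_subset (Finset.range_subset_range.2 (min_le_right _ _)) fun i hi hi' => ?_
    have hmi : m ≤ i := by simp at hi hi'; omega
    have : Module.finrank ℂ T.range ≤ m := by
      simpa using Submodule.finrank_le (T.range)
    rw [T.singularValues_eq_zero_iff_le_finrank_range.2 (this.trans hmi),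
      Real.zero_rpow (by positivity)]
  rw [h1, Finset.sum_range, hG.1.trace_eq_sum_eigenvalues]
  simp only [Complex.coe_algebraMap, Complex.ofReal_sum]
  norm_cast
  trans ∑ i : Fin n, (T.isSymmetric_adjoint_comp_self.eigenvalues hn i) ^ (1 / (L : ℝ))
  · refine Finset.sum_congr rfl fun i _ => ?_
    rw [← T.sq_singularValues_fin hn i, ← Real.rpow_natCast, ← Real.rpow_mul
      (T.singularValues_nonneg _)]
    congr 1
    push_cast
    ring
  · refine Eq.trans ?_ (hs.symm.trans ?_)
    · simp [Finset.sum]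
    · refine Finset.sum_congr rfl fun i _ => ?_
      rw [Complex.ofReal_re, ← Real.rpow_natCast, ← Real.rpow_mul (hG.eigenvalues_nonneg i),
        mul_one_div_cancel hL'.ne', Real.rpow_one]

/-! ### Sequences as families indexed by `ℕ` -/

namespace ComposableSeq

/-- The composable sequence of the first `L` matrices of a family, the first one leftmost. -/
def ofFamily : (d : ℕ → ℕ) → ((i : ℕ) → Matrix (Fin (d i)) (Fin (d (i + 1))) ℂ) → (L : ℕ) →
    ComposableSeq L (d 0) (d L)
  | _, _, 0 => nil
  | d, A, L + 1 => cons (A 0) (ofFamily (fun i => d (i + 1)) (fun i => A (i + 1)) L)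

/-- A family of dimensions with one more in front. -/
def consDim (m : ℕ) (d : ℕ → ℕ) : ℕ → ℕ
  | 0 => m
  | i + 1 => d i

/-- A family of matrices with one more in front. -/
def consFamily {m : ℕ} {d : ℕ → ℕ} (M : Matrix (Fin m) (Fin (d 0)) ℂ)
    (A : (i : ℕ) → Matrix (Fin (d i)) (Fin (d (i + 1))) ℂ) :
    (i : ℕ) → Matrix (Fin (consDim m d i)) (Fin (consDim m d (i + 1))) ℂ
  | 0 => M
  | i + 1 => A i

/-- Every sequence comes from a family. Stating this as an induction principle avoids casts between
sizes. -/
theorem ofFamily_induction {motive : ∀ L m n, ComposableSeq L m n → Prop}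
    (h : ∀ d A L, motive L (d 0) (d L) (ofFamily d A L)) {L m n : ℕ} (s : ComposableSeq L m n) :
    motive L m n s := by
  revert motive
  induction s with
  | @nil n => exact fun h => h (fun _ => n) (fun _ => 0) 0
  | @cons L m k n M s ih =>
    intro motive h
    refine @ih (fun L k n s => ∀ m (M : Matrix (Fin m) (Fin k) ℂ),
      motive (L + 1) m n (cons M s)) (fun d A L m M => ?_) m M
    exact h (consDim m d) (consFamily M A) (L + 1)

/-- The product of the first `L` matrices of a family. -/
abbrev familyProd (d : ℕ → ℕ) (A : (i : ℕ) → Matrix (Fin (d i)) (Fin (d (i + 1))) ℂ) (L : ℕ) :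
    Matrix (Fin (d 0)) (Fin (d L)) ℂ :=
  (ofFamily d A L).prod

theorem familyProd_succ (d : ℕ → ℕ) (A : (i : ℕ) → Matrix (Fin (d i)) (Fin (d (i + 1))) ℂ)
    (L : ℕ) : familyProd d A (L + 1) =
      A 0 * familyProd (fun i => d (i + 1)) (fun i => A (i + 1)) L := rfl

theorem sum_factor_ofFamily (f : (Σ size : ℕ × ℕ, Matrix (Fin size.1) (Fin size.2) ℂ) → ℝ)
    (L : ℕ) (d : ℕ → ℕ) (A : (i : ℕ) → Matrix (Fin (d i)) (Fin (d (i + 1))) ℂ) :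
    ∑ l, f ((ofFamily d A L).factor l) =
      ∑ i ∈ Finset.range L, f ⟨(d i, d (i + 1)), A i⟩ := by
  induction L generalizing d with
  | zero => rfl
  | succ L ih =>
    rw [Fin.sum_univ_castSucc, Finset.sum_range_succ']
    simp only [ofFamily, factor, Fin.snoc_castSucc, Fin.snoc_last, ih]

theorem prod_factor_ofFamily (f : (Σ size : ℕ × ℕ, Matrix (Fin size.1) (Fin size.2) ℂ) → ℝ)
    (L : ℕ) (d : ℕ → ℕ) (A : (i : ℕ) → Matrix (Fin (d i)) (Fin (d (i + 1))) ℂ) :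
    ∏ l, f ((ofFamily d A L).factor l) =
      ∏ i ∈ Finset.range L, f ⟨(d i, d (i + 1)), A i⟩ := by
  induction L generalizing d with
  | zero => rfl
  | succ L ih =>
    rw [Fin.prod_univ_castSucc, Finset.prod_range_succ']
    simp only [ofFamily, factor, Fin.snoc_castSucc, Fin.snoc_last, ih]

theorem continuous_familyProd (L : ℕ) (d : ℕ → ℕ) :
    Continuous fun A : (i : ℕ) → Matrix (Fin (d i)) (Fin (d (i + 1))) ℂ => familyProd d A L := by
  induction L generalizing d with
  | zero => exact continuous_const
  | succ L ih =>
    exact (continuous_apply 0).matrix_mul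
      ((ih fun i => d (i + 1)).comp (continuous_pi fun i => continuous_apply (i + 1)))

theorem familyProd_congr {L : ℕ} {d : ℕ → ℕ}
    {A A' : (i : ℕ) → Matrix (Fin (d i)) (Fin (d (i + 1))) ℂ} (h : ∀ i < L, A i = A' i) :
    familyProd d A L = familyProd d A' L := by
  induction L generalizing d with
  | zero => rfl
  | succ L ih =>
    rw [familyProd_succ, familyProd_succ, h 0 L.succ_pos,
      ih fun i hi => h (i + 1) (Nat.succ_lt_succ hi)]

theorem familyProd_smul (c : ℕ → ℂ) (L : ℕ) (d : ℕ → ℕ)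
    (A : (i : ℕ) → Matrix (Fin (d i)) (Fin (d (i + 1))) ℂ) :
    familyProd d (fun i => c i • A i) L = (∏ i ∈ Finset.range L, c i) • familyProd d A L := by
  induction L generalizing d c with
  | zero => simp [familyProd, ofFamily]
  | succ L ih =>
    rw [familyProd_succ, familyProd_succ, ih fun i => c (i + 1), Finset.prod_range_succ',
      Matrix.smul_mul, Matrix.mul_smul, smul_smul, mul_comm]

theorem familyProd_eq_zero {L : ℕ} {d : ℕ → ℕ}
    {A : (i : ℕ) → Matrix (Fin (d i)) (Fin (d (i + 1))) ℂ} {i : ℕ} (hi : i < L) (h : A i = 0) :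
    familyProd d A L = 0 := by
  induction L generalizing d i with
  | zero => exact absurd hi (Nat.not_lt_zero _)
  | succ L ih =>
    rw [familyProd_succ]
    cases i with
    | zero => rw [h, Matrix.zero_mul]
    | succ i =>
      rw [ih (A := fun i => A (i + 1)) (Nat.lt_of_succ_lt_succ hi) h, Matrix.mul_zero]

/-! ### Minimal families -/

/-- A family whose first `L` matrices minimise the total squared Frobenius norm among all families
of matrices of the same sizes with the same product. -/
def IsMinimal (d : ℕ → ℕ) (A : (i : ℕ) → Matrix (Fin (d i)) (Fin (d (i + 1))) ℂ) (L : ℕ) : Prop :=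
  ∀ A' : (i : ℕ) → Matrix (Fin (d i)) (Fin (d (i + 1))) ℂ, familyProd d A' L = familyProd d A L →
    ∑ i ∈ Finset.range L, frobSq (A i) ≤ ∑ i ∈ Finset.range L, frobSq (A' i)

theorem exists_isMinimal (d : ℕ → ℕ) (A : (i : ℕ) → Matrix (Fin (d i)) (Fin (d (i + 1))) ℂ)
    (L : ℕ) : ∃ A' : (i : ℕ) → Matrix (Fin (d i)) (Fin (d (i + 1))) ℂ,
      familyProd d A' L = familyProd d A L ∧ IsMinimal d A' L := by
  set R := ∑ i ∈ Finset.range L, frobSq (A i)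
  have hcont : Continuous fun A : (i : ℕ) → Matrix (Fin (d i)) (Fin (d (i + 1))) ℂ =>
      ∑ i ∈ Finset.range L, frobSq (A i) :=
    continuous_finsetSum _ fun i _ => continuous_frobSq.comp (continuous_apply i)
  let K : Set ((i : ℕ) → Matrix (Fin (d i)) (Fin (d (i + 1))) ℂ) :=
    Set.pi Set.univ fun _ => Set.pi Set.univ fun _ => Set.pi Set.univ fun _ =>
      Metric.closedBall 0 √R
  have hK : IsCompact K := isCompact_univ_pi fun _ => isCompact_univ_pi fun _ =>
    isCompact_univ_pi fun _ => isCompact_closedBall _ _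
  have hK' : IsCompact (K ∩ {A' | familyProd d A' L = familyProd d A L}) :=
    hK.inter_right (isClosed_eq (continuous_familyProd L d) continuous_const)
  -- Only the first `L` matrices are bounded by `R`; the others are irrelevant and are set to zero
  -- to land in `K`.
  have key : ∀ A' : (i : ℕ) → Matrix (Fin (d i)) (Fin (d (i + 1))) ℂ,
      familyProd d A' L = familyProd d A L → ∑ i ∈ Finset.range L, frobSq (A' i) ≤ R →
      ∃ A'' ∈ K ∩ {A' | familyProd d A' L = familyProd d A L},
        ∑ i ∈ Finset.range L, frobSq (A'' i) = ∑ i ∈ Finset.range L, frobSq (A' i) := by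
    intro A' hA' hR
    refine ⟨fun i => if i < L then A' i else 0, ⟨?_, ?_⟩, ?_⟩
    · intro i _ a _ b _
      by_cases hi : i < L
      · simp only [hi, if_true, mem_closedBall_zero_iff]
        refine Real.le_sqrt_of_sq_le ((norm_apply_sq_le_frobSq _ _ _).trans (le_trans ?_ hR))
        exact Finset.single_le_sum (f := fun i => frobSq (A' i)) (fun _ _ => frobSq_nonneg _)
          (Finset.mem_range.2 hi)
      · simp [hi]
    · exact (familyProd_congr fun i hi => by simp [hi]).trans hA'
    · exact Finset.sum_congr rfl fun i hi => by simp [Finset.mem_range.1 hi]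
  obtain ⟨A₀, hA₀, -⟩ := key A rfl le_rfl
  obtain ⟨A₁, hA₁, hmin⟩ := hK'.exists_isMinOn ⟨A₀, hA₀⟩ hcont.continuousOn
  refine ⟨A₁, hA₁.2, fun A' hA' => ?_⟩
  have hle : ∀ A' : (i : ℕ) → Matrix (Fin (d i)) (Fin (d (i + 1))) ℂ,
      familyProd d A' L = familyProd d A L → ∑ i ∈ Finset.range L, frobSq (A' i) ≤ R →
      ∑ i ∈ Finset.range L, frobSq (A₁ i) ≤ ∑ i ∈ Finset.range L, frobSq (A' i) := by
    intro A' h1 h2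
    obtain ⟨A'', h3, h4⟩ := key A' h1 h2
    exact h4 ▸ hmin h3
  rcases le_total (∑ i ∈ Finset.range L, frobSq (A' i)) R with h | h
  · exact hle A' (hA'.trans hA₁.2) h
  · exact (hle A rfl le_rfl).trans h

theorem IsMinimal.tail {d : ℕ → ℕ} {A : (i : ℕ) → Matrix (Fin (d i)) (Fin (d (i + 1))) ℂ} {L : ℕ}
    (h : IsMinimal d A (L + 1)) : IsMinimal (fun i => d (i + 1)) (fun i => A (i + 1)) L := by
  intro A' hA'
  have := h (fun i => match i with | 0 => A 0 | i + 1 => A' i)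
    (by rw [familyProd_succ, familyProd_succ, ← hA'])
  rw [Finset.sum_range_succ', Finset.sum_range_succ'] at this
  exact le_of_add_le_add_right this

theorem IsMinimal.balanced {d : ℕ → ℕ} {A : (i : ℕ) → Matrix (Fin (d i)) (Fin (d (i + 1))) ℂ}
    {L : ℕ} (h : IsMinimal d A (L + 2)) : (A 0)ᴴ * A 0 = A 1 * (A 1)ᴴ := by
  refine balanced_of_pair_minimal _ _ fun M N hMN => ?_
  have := h (fun i => match i with | 0 => M | 1 => N | i + 2 => A (i + 2)) (by
    rw [familyProd_succ, familyProd_succ, familyProd_succ, familyProd_succ, ← Matrix.mul_assoc,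
      ← Matrix.mul_assoc]
    exact congrArg (· * _) hMN)
  simp only [Finset.sum_range_succ'] at this
  have h1 : ∑ k ∈ Finset.range L, frobSq (A (k + 2)) + frobSq (A 1) + frobSq (A 0) ≤
      ∑ k ∈ Finset.range L, frobSq (A (k + 2)) + frobSq N + frobSq M := this
  linarith

/-- The case `j = 0` is the goal; general `j` makes the induction work. Prepending a factor turns
`j` into `j + 1` for the tail, since balance replaces `(A 0)ᴴ * A 0` by `A 1 * (A 1)ᴴ`. -/
theorem IsMinimal.exists_posSemidef {L : ℕ} {d : ℕ → ℕ}
    {A : (i : ℕ) → Matrix (Fin (d i)) (Fin (d (i + 1))) ℂ} (h : IsMinimal d A (L + 1)) :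
    ∃ G : Matrix (Fin (d (L + 1))) (Fin (d (L + 1))) ℂ, G.PosSemidef ∧
      (∀ j : ℕ, (familyProd d A (L + 1))ᴴ * (A 0 * (A 0)ᴴ) ^ j * familyProd d A (L + 1) =
        G ^ (L + 1 + j)) ∧
      ∀ i < L + 1, (frobSq (A i) : ℂ) = G.trace := by
  have hpow : ∀ {m n : ℕ} (M : Matrix (Fin m) (Fin n) ℂ) (j : ℕ),
      Mᴴ * (M * Mᴴ) ^ j * M = (Mᴴ * M) ^ (j + 1) := by
    intro m n M j
    induction j with
    | zero => simp
    | succ j ih =>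
      rw [pow_succ (Mᴴ * M), ← ih, pow_succ]
      simp only [Matrix.mul_assoc]
  induction L generalizing d with
  | zero =>
    refine ⟨(A 0)ᴴ * A 0, posSemidef_conjTranspose_mul_self _, fun j => ?_, fun i hi => ?_⟩
    · have : familyProd d A (0 + 1) = A 0 := Matrix.mul_one _
      rw [this, hpow, add_comm j]
    · obtain rfl : i = 0 := by omega
      exact ofReal_frobSq' _
  | succ L ih =>
    obtain ⟨G, hG, hj, htr⟩ := ih h.tail
    refine ⟨G, hG, fun j => ?_, fun i hi => ?_⟩
    · rw [familyProd_succ, conjTranspose_mul]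
      have h1 := hj (j + 1)
      rw [← h.balanced, ← hpow] at h1
      rw [show L + 1 + 1 + j = L + 1 + (j + 1) by omega, ← h1]
      simp only [Matrix.mul_assoc]
    · cases i with
      | zero =>
        rw [← htr 0 L.succ_pos, ofReal_frobSq', ofReal_frobSq, h.balanced]
      | succ i => exact htr i (by omega)

theorem IsMinimal.frobSq_eq {L : ℕ} (hL : 0 < L) {d : ℕ → ℕ}
    {A : (i : ℕ) → Matrix (Fin (d i)) (Fin (d (i + 1))) ℂ} (h : IsMinimal d A L) {i : ℕ}
    (hi : i < L) :
    frobSq (A i) = ∑ i ∈ Finset.range (min (d 0) (d L)),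
      (Matrix.toEuclideanLin (familyProd d A L)).singularValues i ^ (2 / (L : ℝ)) := by
  obtain ⟨L, rfl⟩ := Nat.exists_eq_succ_of_ne_zero hL.ne'
  obtain ⟨G, hG, hj, htr⟩ := h.exists_posSemidef
  have h0 := hj 0
  rw [pow_zero, Matrix.mul_one, add_zero] at h0
  have := sum_singularValues_rpow_eq hL hG h0
  exact Complex.ofReal_injective ((htr i hi).trans this.symm)

end ComposableSeq

/-! ### The two bounds and their attainment -/

theorem schattenNorm_rpow {L m n : ℕ} (hL : 0 < L) (B : Matrix (Fin m) (Fin n) ℂ) :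
    schattenNorm (2 / (L : ℝ)) B ^ (2 / (L : ℝ)) = ∑ i ∈ Finset.range (min m n),
      (Matrix.toEuclideanLin B).singularValues i ^ (2 / (L : ℝ)) := by
  have hL' : (0 : ℝ) < L := by exact_mod_cast hL
  unfold schattenNorm
  rw [← Real.rpow_mul (Finset.sum_nonneg fun i _ =>
    Real.rpow_nonneg (LinearMap.singularValues_nonneg _ i) _), one_div_mul_cancel (by positivity),
    Real.rpow_one]

namespace ComposableSeq

theorem mul_schattenNorm_le_sum {L : ℕ} (hL : 0 < L) (d : ℕ → ℕ)
    (A : (i : ℕ) → Matrix (Fin (d i)) (Fin (d (i + 1))) ℂ) :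
    L * schattenNorm (2 / (L : ℝ)) (familyProd d A L) ^ (2 / (L : ℝ)) ≤
      ∑ i ∈ Finset.range L, frobSq (A i) := by
  obtain ⟨A', hA', hmin⟩ := exists_isMinimal d A L
  refine le_trans (le_of_eq ?_) (hmin A hA'.symm)
  rw [Finset.sum_congr rfl fun i hi => hmin.frobSq_eq hL (Finset.mem_range.1 hi), hA',
    ← schattenNorm_rpow hL]
  simp

theorem schattenNorm_le_prod {L : ℕ} (hL : 0 < L) (d : ℕ → ℕ)
    (A : (i : ℕ) → Matrix (Fin (d i)) (Fin (d (i + 1))) ℂ) :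
    schattenNorm (2 / (L : ℝ)) (familyProd d A L) ^ (2 / (L : ℝ)) ≤
      (∏ i ∈ Finset.range L, frobSq (A i)) ^ (1 / (L : ℝ)) := by
  have hL' : (0 : ℝ) < L := by exact_mod_cast hL
  have hP : 0 ≤ ∏ i ∈ Finset.range L, frobSq (A i) :=
    Finset.prod_nonneg fun _ _ => frobSq_nonneg _
  -- A zero factor cannot be rescaled, but then the product is zero and so is the left side.
  by_cases h : ∃ i < L, A i = 0
  · obtain ⟨i, hi, h⟩ := h
    rw [familyProd_eq_zero hi h, schattenNorm_rpow hL, map_zero, LinearMap.singularValues_zero]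
    simp only [Finsupp.coe_zero, Pi.zero_apply]
    rw [Real.zero_rpow (by positivity), Finset.sum_const_zero]
    positivity
  · push Not at h
    have hpos : ∀ i < L, 0 < frobSq (A i) := fun i hi =>
      (frobSq_nonneg _).lt_of_ne' fun h0 => h i hi (eq_zero_of_frobSq_eq_zero h0)
    set g := (∏ i ∈ Finset.range L, frobSq (A i)) ^ (1 / (L : ℝ)) with hg
    have hg0 : 0 ≤ g := by positivity
    have hgL : g ^ L = ∏ i ∈ Finset.range L, frobSq (A i) := by
      rw [hg, ← Real.rpow_natCast, ← Real.rpow_mul hP, one_div_mul_cancel hL'.ne', Real.rpow_one]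
    -- These scalars give every factor the squared norm `g`, the geometric mean, so their product is
    -- `1` and the matrix product is unchanged.
    let c : ℕ → ℝ := fun i => √(g / frobSq (A i))
    have hc : ∏ i ∈ Finset.range L, c i = 1 := by
      have h0 : 0 ≤ ∏ i ∈ Finset.range L, c i := Finset.prod_nonneg fun _ _ => Real.sqrt_nonneg _
      rw [← sq_eq_sq₀ h0 zero_le_one, ← Finset.prod_pow, one_pow]
      have : ∀ i ∈ Finset.range L, c i ^ 2 = g / frobSq (A i) := fun i _ =>
        Real.sq_sqrt (div_nonneg hg0 (frobSq_nonneg _))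
      rw [Finset.prod_congr rfl this, Finset.prod_div_distrib, Finset.prod_const,
        Finset.card_range, hgL, div_self]
      exact (Finset.prod_pos fun i hi => hpos i (Finset.mem_range.1 hi)).ne'
    have hle := mul_schattenNorm_le_sum hL d fun i => (c i : ℂ) • A i
    rw [familyProd_smul, ← Complex.ofReal_prod, hc, Complex.ofReal_one, one_smul] at hle
    have : ∀ i ∈ Finset.range L, frobSq ((c i : ℂ) • A i) = g := by
      intro i hi
      rw [frobSq_smul, Real.sq_sqrt (div_nonneg hg0 (frobSq_nonneg _)),
        div_mul_cancel₀ _ (hpos i (Finset.mem_range.1 hi)).ne']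
    rw [Finset.sum_congr rfl this, Finset.sum_const, Finset.card_range, nsmul_eq_mul] at hle
    exact le_of_mul_le_mul_left hle hL'

/-- Padding `B` with identities supplies sizes in which to minimise. -/
theorem nonempty_prod_eq {L m n : ℕ} (hL : 0 < L) (B : Matrix (Fin m) (Fin n) ℂ) :
    ∃ s : ComposableSeq L m n, s.prod = B := by
  have hone : ∀ L, ∃ s : ComposableSeq L n n, s.prod = 1 := by
    intro L
    induction L with
    | zero => exact ⟨nil, rfl⟩
    | succ L ih =>
      obtain ⟨s, hs⟩ := ih
      exact ⟨cons 1 s, by rw [prod, hs, Matrix.one_mul]⟩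
  obtain ⟨L, rfl⟩ := Nat.exists_eq_succ_of_ne_zero hL.ne'
  obtain ⟨s, hs⟩ := hone L
  exact ⟨cons B s, by rw [prod, hs, Matrix.mul_one]⟩

theorem schattenNorm_le {L m n : ℕ} (hL : 0 < L) (s : ComposableSeq L m n) :
    schattenNorm (2 / (L : ℝ)) s.prod ^ (2 / (L : ℝ)) ≤
        (∏ l : Fin L, frobeniusNorm (s.factor l).2 ^ 2) ^ (1 / (L : ℝ)) ∧
      schattenNorm (2 / (L : ℝ)) s.prod ^ (2 / (L : ℝ)) ≤
        1 / (L : ℝ) * ∑ l : Fin L, frobeniusNorm (s.factor l).2 ^ 2 := by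
  simp only [frobeniusNorm_sq]
  refine ofFamily_induction (motive := fun L m n s => 0 < L →
    schattenNorm (2 / (L : ℝ)) s.prod ^ (2 / (L : ℝ)) ≤
        (∏ l : Fin L, frobSq (s.factor l).2) ^ (1 / (L : ℝ)) ∧
      schattenNorm (2 / (L : ℝ)) s.prod ^ (2 / (L : ℝ)) ≤
        1 / (L : ℝ) * ∑ l : Fin L, frobSq (s.factor l).2) (fun d A L hL => ?_) s hL
  have hL' : (0 : ℝ) < L := by exact_mod_cast hL
  rw [sum_factor_ofFamily fun x => frobSq x.2, prod_factor_ofFamily fun x => frobSq x.2]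
  refine ⟨schattenNorm_le_prod hL d A, ?_⟩
  rw [one_div_mul_eq_div, le_div_iff₀' hL']
  exact mul_schattenNorm_le_sum hL d A

theorem exists_schattenNorm_eq {L m n : ℕ} (hL : 0 < L) (s : ComposableSeq L m n) :
    ∃ t : ComposableSeq L m n, t.prod = s.prod ∧
      schattenNorm (2 / (L : ℝ)) s.prod ^ (2 / (L : ℝ)) =
        (∏ l : Fin L, frobeniusNorm (t.factor l).2 ^ 2) ^ (1 / (L : ℝ)) ∧
      schattenNorm (2 / (L : ℝ)) s.prod ^ (2 / (L : ℝ)) =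
        1 / (L : ℝ) * ∑ l : Fin L, frobeniusNorm (t.factor l).2 ^ 2 := by
  simp only [frobeniusNorm_sq]
  refine ofFamily_induction (motive := fun L m n s => 0 < L →
    ∃ t : ComposableSeq L m n, t.prod = s.prod ∧
      schattenNorm (2 / (L : ℝ)) s.prod ^ (2 / (L : ℝ)) =
        (∏ l : Fin L, frobSq (t.factor l).2) ^ (1 / (L : ℝ)) ∧
      schattenNorm (2 / (L : ℝ)) s.prod ^ (2 / (L : ℝ)) =
        1 / (L : ℝ) * ∑ l : Fin L, frobSq (t.factor l).2) (fun d A L hL => ?_) s hL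
  have hL' : (0 : ℝ) < L := by exact_mod_cast hL
  obtain ⟨A', hA', hmin⟩ := exists_isMinimal d A L
  have heq : ∀ i ∈ Finset.range L, frobSq (A' i) =
      schattenNorm (2 / (L : ℝ)) (familyProd d A L) ^ (2 / (L : ℝ)) := by
    intro i hi
    rw [hmin.frobSq_eq hL (Finset.mem_range.1 hi), hA', schattenNorm_rpow hL]
  have h0 : 0 ≤ schattenNorm (2 / (L : ℝ)) (familyProd d A L) ^ (2 / (L : ℝ)) :=
    heq 0 (Finset.mem_range.2 hL) ▸ frobSq_nonneg _
  refine ⟨ofFamily d A' L, hA', ?_, ?_⟩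
  · rw [prod_factor_ofFamily fun x => frobSq x.2, Finset.prod_congr rfl heq, Finset.prod_const,
      Finset.card_range, ← Real.rpow_natCast, ← Real.rpow_mul h0, mul_one_div_cancel hL'.ne',
      Real.rpow_one]
  · rw [sum_factor_ofFamily fun x => frobSq x.2, Finset.sum_congr rfl heq, Finset.sum_const,
      Finset.card_range, nsmul_eq_mul, one_div, inv_mul_cancel_left₀ hL'.ne']

end ComposableSeq

theorem mainTheorem3 (L : ℕ) (hL : 0 < L) (m n : ℕ) (B : Matrix (Fin m) (Fin n) ℂ) :
    IsLeast
        {x : ℝ | ∃ s : ComposableSeq L m n, s.prod = B ∧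
          x = (∏ l : Fin L, frobeniusNorm (s.factor l).2 ^ 2) ^ (1 / (L : ℝ))}
        (schattenNorm (2 / (L : ℝ)) B ^ (2 / (L : ℝ))) ∧
      IsLeast
        {x : ℝ | ∃ s : ComposableSeq L m n, s.prod = B ∧
          x = 1 / (L : ℝ) * ∑ l : Fin L, frobeniusNorm (s.factor l).2 ^ 2}
        (schattenNorm (2 / (L : ℝ)) B ^ (2 / (L : ℝ))) := by
  obtain ⟨s, rfl⟩ := ComposableSeq.nonempty_prod_eq hL B
  obtain ⟨t, ht, hp, hs⟩ := s.exists_schattenNorm_eq hL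
  refine ⟨⟨⟨t, ht, hp⟩, ?_⟩, ⟨⟨t, ht, hs⟩, ?_⟩⟩
  · rintro x ⟨u, hu, rfl⟩
    exact hu ▸ (u.schattenNorm_le hL).1
  · rintro x ⟨u, hu, rfl⟩
    exact hu ▸ (u.schattenNorm_le hL).2
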